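/- Consider a radial distribution grid: a tree on the buses $0,1,\dots,N$ with root (substation) $0$, whose $N$ lines $\ell$ have resistances $r_\ell\in\mathbb R$ and reactances $x_\ell>0$. Let $M\in\mathbb R^{N\times N}$ be the signed incidence matrix of the tree with the row of bus $0$ removed, let $R=M^{-\top}\operatorname{diag}(r)M^{-1}$ and $X=M^{-\top}\operatorname{diag}(x)M^{-1}$, and for a fixed vector $p\in\mathbb R^N$ of active power injections let $\hat v=Rp+\mathbf 1$. Let an arbitrary undirected communication graph on $\{1,\dots,N\}$ be given, let $\mathcal N_i$ be the set of neighbors of $i$ in it, and for each $i$ let $\phi_i:\mathbb R^{|\mathcal N_i|+1}\to\mathcal Q_i=[q_{i,\min},q_{i,\max}]$ be a continuous function of $(v_i,\{v_j\}_{j\in\mathcal N_i})$. Write $\phi(v)=\big(\phi_i(v_i,\{v_j\}_{j\in\mathcal N_i})\big)_{i=1}^N$ for $v\in\mathbb R^N$. For a stepsize $\epsilon\in(0,1]$ consider the closed-loop system $$q(t+1)=q(t)+\epsilon\big(\phi(v(t))-q(t)\big),\qquad v(t+1)=Xq(t+1)+\hat v .$$ Suppose that $\phi$ is monotonically decreasing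 in the collective sense, i.e. $$\big(\phi(v)-\phi(v')\big)^\top(v-v')\le 0\qquad\text{for all } v,v'\in\mathbb R^N,$$ or equivalently $\sum_{i=1}^N\big(\phi_i(v_i,\{v_j\}_{j\in\mathcal N_i})-\phi_i(v'_i,\{v'_j\}_{j\in\mathcal N_i})\big)(v_i-v'_i)\le 0$ for all $v,v'\in\mathbb R^N$. Then there is exactly one pair $(v^\star,q^\star)\in\mathbb R^N\times\mathbb R^N$ with $$\phi(v^\star)=q^\star,\qquad v^\star=Xq^\star+\hat v,$$ and for every $\epsilon\in(0,1]$ this pair is the unique equilibrium (fixed point) of the closed-loop system. -/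

import Mathlib

open Matrix

noncomputable section

/-- A radial distribution grid with buses `0, …, N` (bus `0` is the substation): a tree on the
buses whose `N` lines are labelled by `Fin N` (each edge of the tree carries exactly one label),
line `l` running from `src l` to `dst l`, with resistance `r l` and reactance `x l > 0`.
The orientation of the lines is arbitrary. -/
structure RadialGrid (N : ℕ) where
  graph : SimpleGraph (Fin (N + 1))
  isTree : graph.IsTree
  src : Fin N → Fin (N + 1)
  dst : Fin N → Fin (N + 1)
  adj : ∀ l, graph.Adj (src l) (dst l)
  lines_bijective :
    Function.Bijective (fun l => (⟨s(src l, dst l), adj l⟩ : graph.edgeSet))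
  r : Fin N → ℝ
  x : Fin N → ℝ
  x_pos : ∀ l, 0 < x l

namespace RadialGrid

variable {N : ℕ} (g : RadialGrid N)

/-- The full `(N + 1) × N` signed incidence matrix. -/
def fullIncidence : Matrix (Fin (N + 1)) (Fin N) ℝ :=
  Matrix.of fun n l => if n = g.src l then 1 else if n = g.dst l then -1 else 0

/-- The incidence matrix `M` with the row of the substation removed;
row `i : Fin N` belongs to bus `i.succ`. -/
def incidence : Matrix (Fin N) (Fin N) ℝ :=
  g.fullIncidence.submatrix Fin.succ id

/-- `R = M⁻ᵀ D_r M⁻¹`. -/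
def R : Matrix (Fin N) (Fin N) ℝ :=
  (g.incidence⁻¹)ᵀ * Matrix.diagonal g.r * g.incidence⁻¹

/-- `X = M⁻ᵀ D_x M⁻¹`. -/
def X : Matrix (Fin N) (Fin N) ℝ :=
  (g.incidence⁻¹)ᵀ * Matrix.diagonal g.x * g.incidence⁻¹

/-- `v̂ = R p + 1`, for the constant active power injections `p`. -/
def vHat (p : Fin N → ℝ) : Fin N → ℝ :=
  g.R *ᵥ p + 1

end RadialGrid

/-- The buses whose voltage is available to bus `i`: itself and its neighbours in the
communication network `comm`. -/
abbrev Accessible {N : ℕ} (comm : SimpleGraph (Fin N)) (i : Fin N) : Type :=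
  {j : Fin N // j = i ∨ comm.Adj i j}

/-- Equilibrium functions over the communication network `comm`: `φ i` maps the accessible
voltages of bus `i` into the interval `[qmin i, qmax i]`. -/
abbrev EquilibriumFunctions {N : ℕ} (comm : SimpleGraph (Fin N)) (qmin qmax : Fin N → ℝ) : Type :=
  (i : Fin N) → (Accessible comm i → ℝ) → Set.Icc (qmin i) (qmax i)

namespace EquilibriumFunctions

variable {N : ℕ} {comm : SimpleGraph (Fin N)} {qmin qmax : Fin N → ℝ}

/-- The stacked function `v ↦ (φ_i(v_i, {v_j}))_i`. -/
def stack (φ : EquilibriumFunctions comm qmin qmax) (v : Fin N → ℝ) : Fin N → ℝ :=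
  fun i => (φ i (fun j => v j.1) : ℝ)

/-- `φ` is collectively monotonically decreasing: `(φ(v) - φ(v'))ᵀ (v - v') ≤ 0`. -/
def CollectivelyDecreasing (φ : EquilibriumFunctions comm qmin qmax) : Prop :=
  ∀ v v' : Fin N → ℝ, (φ.stack v - φ.stack v') ⬝ᵥ (v - v') ≤ 0

end EquilibriumFunctions

/-- One step `(v(t), q(t)) ↦ (v(t+1), q(t+1))` of the closed-loop system with stepsize `ε`:
`q(t+1) = q(t) + ε (φ(v(t)) - q(t))`, `v(t+1) = X q(t+1) + v̂`. -/
def closedLoopStep {N : ℕ} (g : RadialGrid N) (p : Fin N → ℝ) {comm : SimpleGraph (Fin N)}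
    {qmin qmax : Fin N → ℝ} (φ : EquilibriumFunctions comm qmin qmax) (ε : ℝ)
    (s : (Fin N → ℝ) × (Fin N → ℝ)) : (Fin N → ℝ) × (Fin N → ℝ) :=
  (g.X *ᵥ (s.2 + ε • (φ.stack s.1 - s.2)) + g.vHat p, s.2 + ε • (φ.stack s.1 - s.2))

end

/-!
Eliminating `v = X q + w` leaves the equation `f (X q + w) = q`, that is, the vanishing of
`G q = (q - f (X q + w))ᵀ X`. Since `f` is decreasing,
`(G q - G q')ᵀ (q - q') ≥ (q - q')ᵀ X (q - q') ≥ c ‖q - q'‖²` for some `c > 0`, so `G` is strongly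
monotone. A continuous strongly monotone map on `ℝⁿ` has exactly one zero: annihilate its
components one at a time. Once the components in `s` vanish, the solution depends continuously on
the coordinate `a ∉ s`, and along it the component `a` is a strongly monotone function of one real
variable, which has a zero by the intermediate value theorem.

The matrix `X` is positive definite because the reduced incidence matrix is invertible: a vector in
its left kernel is a potential that vanishes at the root and is constant along every line of the
tree, hence zero.
-/

theorem exists_eq_zero_of_mul_sq_le {c : ℝ} {g : ℝ → ℝ} (hc : 0 < c) (hcont : Continuous g)
    (hg : ∀ t t', c * (t - t') ^ 2 ≤ (g t - g t') * (t - t')) : ∃ t, g t = 0 := by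
  obtain ⟨τ, hτ, hcτ⟩ : ∃ τ > 0, c * τ = |g 0| + 1 :=
    ⟨(|g 0| + 1) / c, by positivity, mul_div_cancel₀ _ hc.ne'⟩
  have hleft : c * τ ≤ g 0 - g (-τ) := le_of_mul_le_mul_right (by linarith [hg (-τ) 0]) hτ
  have hright : c * τ ≤ g τ - g 0 := le_of_mul_le_mul_right (by linarith [hg τ 0]) hτ
  exact mem_range_of_exists_le_of_exists_ge hcont
    ⟨-τ, by linarith [le_abs_self (g 0)]⟩ ⟨τ, by linarith [neg_abs_le (g 0)]⟩

section StronglyMonotone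

variable {ι : Type*} [Fintype ι] {c : ℝ} {T : (ι → ℝ) → ι → ℝ}

/-- Strong monotonicity of `T` with modulus `c`. The norm is the sup norm of `ι → ℝ`; another norm
would only change the modulus. -/
def StronglyMonotoneWith (c : ℝ) (T : (ι → ℝ) → ι → ℝ) : Prop :=
  ∀ u v, c * ‖u - v‖ ^ 2 ≤ (T u - T v) ⬝ᵥ (u - v)

namespace StronglyMonotoneWith

theorem injective (hT : StronglyMonotoneWith c T) (hc : 0 < c) : Function.Injective T := by
  intro u v huv
  have h := hT u v
  rw [huv, sub_self, zero_dotProduct] at h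
  have hsq : ‖u - v‖ ^ 2 = 0 := le_antisymm (nonpos_of_mul_nonpos_right h hc) (sq_nonneg _)
  exact sub_eq_zero.1 (norm_eq_zero.1 (pow_eq_zero_iff two_ne_zero |>.1 hsq))

theorem mul_norm_sub_le_sum_abs (hT : StronglyMonotoneWith c T) {s : Finset ι} {u v : ι → ℝ}
    (hoff : ∀ i ∉ s, u i = v i) (hv : ∀ i ∈ s, T v i = 0) :
    c * ‖u - v‖ ≤ ∑ i ∈ s, |T u i| := by
  rcases (norm_nonneg (u - v)).eq_or_lt with hzero | hpos
  · rw [← hzero, mul_zero]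
    exact Finset.sum_nonneg fun i _ => abs_nonneg _
  refine le_of_mul_le_mul_right ?_ hpos
  calc c * ‖u - v‖ * ‖u - v‖ = c * ‖u - v‖ ^ 2 := by ring
    _ ≤ ∑ i, (T u - T v) i * (u - v) i := hT u v
    _ = ∑ i ∈ s, T u i * (u - v) i := by
      rw [← Finset.sum_subset s.subset_univ fun i _ hi => by simp [hoff i hi]]
      exact Finset.sum_congr rfl fun i hi => by simp [hv i hi]
    _ ≤ ∑ i ∈ s, |T u i| * ‖u - v‖ := Finset.sum_le_sum fun i _ =>
      (le_abs_self _).trans <| (abs_mul _ _).trans_le <|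
        mul_le_mul_of_nonneg_left (norm_le_pi_norm (u - v) i) (abs_nonneg _)
    _ = (∑ i ∈ s, |T u i|) * ‖u - v‖ := (Finset.sum_mul _ _ _).symm

theorem continuous_of_partial_zero (hT : StronglyMonotoneWith c T) (hc : 0 < c)
    (hcont : Continuous T) {α : Type*} [TopologicalSpace α] {s : Finset ι} {b x : α → ι → ℝ}
    (hb : Continuous b) (hoff : ∀ t, ∀ i ∉ s, x t i = b t i) (hzero : ∀ t, ∀ i ∈ s, T (x t) i = 0) :
    Continuous x := by
  classical
  refine continuous_iff_continuousAt.2 fun t₀ => ?_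
  -- `y t` agrees with `x t` off `s`, and tends to `y t₀ = x t₀`, where `T` vanishes on `s`.
  let y : α → ι → ℝ := fun t => s.piecewise (x t₀) (b t)
  have hy : Continuous y := continuous_pi fun i => by
    by_cases hi : i ∈ s
    · simpa only [y, Finset.piecewise_eq_of_mem _ _ _ hi] using continuous_const
    · simpa only [y, Finset.piecewise_eq_of_notMem _ _ _ hi] using continuous_pi_iff.1 hb i
  have hyt₀ : y t₀ = x t₀ := by
    funext i
    by_cases hi : i ∈ s
    · exact Finset.piecewise_eq_of_mem _ _ _ hi
    · exact (Finset.piecewise_eq_of_notMem _ _ _ hi).trans (hoff t₀ i hi).symm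
  have hbound : ∀ t, ‖y t - x t‖ ≤ c⁻¹ * ∑ i ∈ s, |T (y t) i| := fun t => by
    rw [le_inv_mul_iff₀ hc]
    refine hT.mul_norm_sub_le_sum_abs (fun i hi => ?_) (hzero t)
    exact (Finset.piecewise_eq_of_notMem _ _ _ hi).trans (hoff t i hi).symm
  have hlim : Filter.Tendsto (fun t => c⁻¹ * ∑ i ∈ s, |T (y t) i|) (nhds t₀) (nhds 0) := by
    have hres : Continuous fun t => c⁻¹ * ∑ i ∈ s, |T (y t) i| := by fun_prop
    convert hres.tendsto t₀
    rw [hyt₀, Finset.sum_eq_zero fun i hi => abs_eq_zero.2 (hzero t₀ i hi), mul_zero]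
  have hdiff := squeeze_zero_norm hbound hlim
  simpa only [ContinuousAt, hyt₀, sub_sub_cancel, sub_zero] using (hy.tendsto t₀).sub hdiff

theorem exists_partial_zero (hT : StronglyMonotoneWith c T) (hc : 0 < c) (hcont : Continuous T)
    (s : Finset ι) (b : ι → ℝ) : ∃ u, (∀ i ∉ s, u i = b i) ∧ ∀ i ∈ s, T u i = 0 := by
  classical
  induction s using Finset.induction_on generalizing b with
  | empty => exact ⟨b, fun _ _ => rfl, by simp⟩
  | insert a s ha ih =>
    choose x hoff hzero using fun t : ℝ => ih (Function.update b a t)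
    have hx : Continuous x :=
      hT.continuous_of_partial_zero hc hcont (continuous_const.update a continuous_id) hoff hzero
    have hxa : ∀ t, x t a = t := fun t => by rw [hoff t a ha, Function.update_self]
    have hxoff : ∀ t, ∀ i ∉ insert a s, x t i = b i := fun t i hi => by
      rw [Finset.mem_insert, not_or] at hi
      rw [hoff t i hi.2, Function.update_of_ne hi.1]
    have hpair : ∀ t t', (T (x t) - T (x t')) ⬝ᵥ (x t - x t') =
        (T (x t) a - T (x t') a) * (t - t') := fun t t' => by
      rw [dotProduct, Finset.sum_eq_single_of_mem a (Finset.mem_univ a), Pi.sub_apply, Pi.sub_apply,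
        hxa, hxa]
      intro i _ hia
      by_cases hi : i ∈ s
      · simp [hzero _ i hi]
      · simp [hxoff _ i (by simp [hia, hi])]
    obtain ⟨t, ht⟩ : ∃ t, T (x t) a = 0 :=
      exists_eq_zero_of_mul_sq_le hc (by fun_prop) fun t t' => by
        have hdist : |t - t'| ≤ ‖x t - x t'‖ := by
          simpa only [Pi.sub_apply, hxa, Real.norm_eq_abs] using norm_le_pi_norm (x t - x t') a
        calc c * (t - t') ^ 2 = c * |t - t'| ^ 2 := by rw [sq_abs]
          _ ≤ c * ‖x t - x t'‖ ^ 2 := by gcongr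
          _ ≤ (T (x t) a - T (x t') a) * (t - t') := hpair t t' ▸ hT (x t) (x t')
    exact ⟨x t, hxoff t, Finset.forall_mem_insert _ _ _ |>.2 ⟨ht, hzero t⟩⟩

theorem existsUnique_eq_zero (hT : StronglyMonotoneWith c T) (hc : 0 < c) (hcont : Continuous T) :
    ∃! u, T u = 0 := by
  obtain ⟨u, -, hu⟩ := hT.exists_partial_zero hc hcont Finset.univ 0
  have hu0 : T u = 0 := funext fun i => hu i (Finset.mem_univ i)
  exact ⟨u, hu0, fun v hv => hT.injective hc (hv.trans hu0.symm)⟩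

end StronglyMonotoneWith

end StronglyMonotone

section Equilibrium

variable {ι : Type*} [Fintype ι] {X : Matrix ι ι ℝ} {f : (ι → ℝ) → ι → ℝ}

theorem exists_mul_norm_sq_le_dotProduct_mulVec (hX : ∀ u ≠ 0, 0 < u ⬝ᵥ X *ᵥ u) :
    ∃ c > 0, ∀ u, c * ‖u‖ ^ 2 ≤ u ⬝ᵥ X *ᵥ u := by
  obtain ⟨c, hc, hsphere⟩ := (isCompact_sphere (0 : ι → ℝ) 1).exists_forall_le'
    (f := fun u => u ⬝ᵥ X *ᵥ u) (by fun_prop) fun u hu => hX u (ne_zero_of_mem_unit_sphere ⟨u, hu⟩)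
  refine ⟨c, hc, fun u => ?_⟩
  rcases eq_or_ne u 0 with rfl | hu
  · simp
  have hunit := hsphere (‖u‖⁻¹ • u) (by simp [norm_smul, hu])
  have hnorm : 0 < ‖u‖ := norm_pos_iff.2 hu
  rw [mulVec_smul, smul_dotProduct, dotProduct_smul, smul_eq_mul, smul_eq_mul, ← mul_assoc,
    ← mul_inv, ← sq, le_inv_mul_iff₀ (by positivity)] at hunit
  linarith

theorem stronglyMonotoneWith_sub_vecMul {c : ℝ} (hX : ∀ u, c * ‖u‖ ^ 2 ≤ u ⬝ᵥ X *ᵥ u)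
    (hf : ∀ v v', (f v - f v') ⬝ᵥ (v - v') ≤ 0) (w : ι → ℝ) :
    StronglyMonotoneWith c fun q => (q - f (X *ᵥ q + w)) ᵥ* X := by
  intro q q'
  have hdec := hf (X *ᵥ q + w) (X *ᵥ q' + w)
  rw [add_sub_add_right_eq_sub, ← mulVec_sub] at hdec
  rw [← sub_vecMul, ← dotProduct_mulVec, sub_sub_sub_comm, sub_dotProduct]
  linarith [hX (q - q')]

theorem vecMul_eq_zero_iff_of_dotProduct_mulVec_pos (hX : ∀ u ≠ 0, 0 < u ⬝ᵥ X *ᵥ u)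
    {u : ι → ℝ} : u ᵥ* X = 0 ↔ u = 0 := by
  refine ⟨fun hu => ?_, fun hu => hu ▸ zero_vecMul X⟩
  by_contra hne
  have hpos := hX u hne
  rw [dotProduct_mulVec, hu, zero_dotProduct] at hpos
  exact hpos.false

theorem existsUnique_apply_mulVec_add_eq (hX : ∀ u ≠ 0, 0 < u ⬝ᵥ X *ᵥ u) (hcont : Continuous f)
    (hf : ∀ v v', (f v - f v') ⬝ᵥ (v - v') ≤ 0) (w : ι → ℝ) :
    ∃! q, f (X *ᵥ q + w) = q := by
  obtain ⟨c, hc, hcX⟩ := exists_mul_norm_sq_le_dotProduct_mulVec hX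
  have hzero : ∀ q, (q - f (X *ᵥ q + w)) ᵥ* X = 0 ↔ f (X *ᵥ q + w) = q := fun q => by
    rw [vecMul_eq_zero_iff_of_dotProduct_mulVec_pos hX, sub_eq_zero, eq_comm]
  simpa only [hzero] using (stronglyMonotoneWith_sub_vecMul hcX hf w).existsUnique_eq_zero hc
    (by fun_prop)

end Equilibrium

section RelaxedStep

variable {𝕜 V Q : Type*} [DivisionRing 𝕜] [AddCommGroup Q] [Module 𝕜 Q]

/-- One step `(v, q) ↦ (h q⁺, q⁺)`, `q⁺ = q + ε (f v - q)`, of the closed loop in which a control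
law `f` with stepsize `ε` acts on a plant `v = h q`. -/
def relaxedStep (f : V → Q) (h : Q → V) (ε : 𝕜) (s : V × Q) : V × Q :=
  (h (s.2 + ε • (f s.1 - s.2)), s.2 + ε • (f s.1 - s.2))

theorem isFixedPt_relaxedStep_iff {f : V → Q} {h : Q → V} {ε : 𝕜} (hε : ε ≠ 0) {v : V} {q : Q} :
    Function.IsFixedPt (relaxedStep f h ε) (v, q) ↔ f v = q ∧ v = h q := by
  have hq : q + ε • (f v - q) = q ↔ f v = q := by
    rw [add_eq_left, smul_eq_zero_iff_right hε, sub_eq_zero]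
  simp only [Function.IsFixedPt, relaxedStep, Prod.mk.injEq, hq]
  constructor
  · rintro ⟨hv, hfv⟩
    rw [hq.2 hfv] at hv
    exact ⟨hfv, hv.symm⟩
  · rintro ⟨hfv, hv⟩
    rw [hq.2 hfv]
    exact ⟨hv.symm, hfv⟩

end RelaxedStep

namespace RadialGrid

variable {N : ℕ} (g : RadialGrid N)

theorem fullIncidence_apply (n : Fin (N + 1)) (l : Fin N) :
    g.fullIncidence n l = (if n = g.src l then 1 else 0) - if n = g.dst l then 1 else 0 := by
  have hne : g.src l ≠ g.dst l := (g.adj l).ne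
  simp only [fullIncidence, of_apply]
  split_ifs <;> simp_all

theorem vecMul_incidence_apply (u : Fin N → ℝ) (l : Fin N) :
    (u ᵥ* g.incidence) l =
      (Fin.cons 0 u : Fin (N + 1) → ℝ) (g.src l) - (Fin.cons 0 u : Fin (N + 1) → ℝ) (g.dst l) := by
  calc (u ᵥ* g.incidence) l
      = ∑ n, (Fin.cons 0 u : Fin (N + 1) → ℝ) n * g.fullIncidence n l := by
        simp [Fin.sum_univ_succ, vecMul, dotProduct, incidence]
    _ = _ := by simp [fullIncidence_apply, mul_sub]

theorem potential_eq_of_forall_line {w : Fin (N + 1) → ℝ} (hw : ∀ l, w (g.src l) = w (g.dst l))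
    (a b : Fin (N + 1)) : w a = w b := by
  classical
  have hadj : ∀ a b, g.graph.Adj a b → w a = w b := by
    intro a b hab
    obtain ⟨l, hl⟩ := g.lines_bijective.2 ⟨s(a, b), hab⟩
    rcases Sym2.eq_iff.1 (congrArg Subtype.val hl) with ⟨rfl, rfl⟩ | ⟨rfl, rfl⟩
    exacts [hw l, (hw l).symm]
  exact g.graph.lapMatrix_mulVec_eq_zero_iff_forall_reachable.1
    (g.graph.lapMatrix_mulVec_eq_zero_iff_forall_adj.2 hadj) a b
    (g.isTree.connected.preconnected a b)

theorem isUnit_incidence : IsUnit g.incidence := by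
  refine vecMul_injective_iff_isUnit.1 <|
    (injective_iff_map_eq_zero g.incidence.vecMulLinear).2 fun u hu => funext fun i => ?_
  have hline : ∀ l, (Fin.cons 0 u : Fin (N + 1) → ℝ) (g.src l) =
      (Fin.cons 0 u : Fin (N + 1) → ℝ) (g.dst l) := fun l =>
    sub_eq_zero.1 <| (g.vecMul_incidence_apply u l).symm.trans (congrFun hu l)
  exact g.potential_eq_of_forall_line hline i.succ 0

theorem posDef_X : g.X.PosDef := by
  rw [X, ← conjTranspose_eq_transpose_of_trivial]
  exact (PosDef.diagonal g.x_pos).conjTranspose_mul_mul_same <|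
    mulVec_injective_iff_isUnit.2 <| isUnit_nonsing_inv_iff.2 g.isUnit_incidence

end RadialGrid

theorem EquilibriumFunctions.continuous_stack {N : ℕ} {comm : SimpleGraph (Fin N)}
    {qmin qmax : Fin N → ℝ} {φ : EquilibriumFunctions comm qmin qmax}
    (hcont : ∀ i, Continuous (φ i)) : Continuous φ.stack :=
  continuous_pi fun i => continuous_subtype_val.comp <|
    (hcont i).comp <| continuous_pi fun j => continuous_apply j.1

theorem mainTheorem2_general {ι : Type*} [Fintype ι] {X : Matrix ι ι ℝ}
    (hX : ∀ u ≠ 0, 0 < u ⬝ᵥ X *ᵥ u) (w : ι → ℝ) {f : (ι → ℝ) → ι → ℝ} (hcont : Continuous f)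
    (hf : ∀ v v', (f v - f v') ⬝ᵥ (v - v') ≤ 0) :
    ∃ vs qs : ι → ℝ,
      (f vs = qs ∧ vs = X *ᵥ qs + w) ∧
      (∀ v q, f v = q ∧ v = X *ᵥ q + w → v = vs ∧ q = qs) ∧
      ∀ ε : ℝ, ε ≠ 0 → ∀ v q,
        Function.IsFixedPt (relaxedStep f (X *ᵥ · + w) ε) (v, q) ↔ v = vs ∧ q = qs := by
  obtain ⟨qs, hqs, huniq⟩ := existsUnique_apply_mulVec_add_eq hX hcont hf w
  have hpair : ∀ v q, f v = q ∧ v = X *ᵥ q + w ↔ v = X *ᵥ qs + w ∧ q = qs := by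
    refine fun v q => ⟨?_, ?_⟩
    · rintro ⟨hq, rfl⟩
      obtain rfl := huniq q hq
      exact ⟨rfl, rfl⟩
    · rintro ⟨rfl, rfl⟩
      exact ⟨hqs, rfl⟩
  exact ⟨X *ᵥ qs + w, qs, ⟨hqs, rfl⟩, fun v q => (hpair v q).1,
    fun ε hε v q => (isFixedPt_relaxedStep_iff hε).trans (hpair v q)⟩

theorem mainTheorem2 {N : ℕ} (g : RadialGrid N) (p : Fin N → ℝ)
    (comm : SimpleGraph (Fin N)) (qmin qmax : Fin N → ℝ)
    (φ : EquilibriumFunctions comm qmin qmax) (hcont : ∀ i, Continuous (φ i)) :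
    (φ.CollectivelyDecreasing ↔
      ∀ v v' : Fin N → ℝ,
        ∑ i, ((φ i (fun j => v j.1) : ℝ) - (φ i (fun j => v' j.1) : ℝ)) * (v i - v' i) ≤ 0) ∧
    (φ.CollectivelyDecreasing →
      ∃ vs qs : Fin N → ℝ,
        (φ.stack vs = qs ∧ vs = g.X.mulVec qs + g.vHat p) ∧
        (∀ v q : Fin N → ℝ, φ.stack v = q ∧ v = g.X.mulVec q + g.vHat p → v = vs ∧ q = qs) ∧
        (∀ ε : ℝ, 0 < ε → ε ≤ 1 → ∀ v q : Fin N → ℝ,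
          Function.IsFixedPt (closedLoopStep g p φ ε) (v, q) ↔ v = vs ∧ q = qs)) := by
  refine ⟨Iff.rfl, fun hφ => ?_⟩
  obtain ⟨vs, qs, hsol, huniq, hfix⟩ := mainTheorem2_general
    (fun u hu => by simpa using g.posDef_X.dotProduct_mulVec_pos hu) (g.vHat p)
    (EquilibriumFunctions.continuous_stack hcont) hφ
  exact ⟨vs, qs, hsol, huniq, fun ε hε _ => hfix ε hε.ne'⟩
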